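/- Throughout, $\lambda$ is Lebesgue measure on $\mathbb R$, $|A|=\lambda(A)$, and $L^\infty$ spaces are real. For a compact set $K\subseteq\mathbb R$ of positive measure put $$\pi_K(x)=\lambda([\min K,x]\cap K)\quad(x\in K),\qquad \sigma_K(t)=\min\pi_K^{-1}(t),\qquad E_K=\{t\in[0,|K|]:\#\pi_K^{-1}(t)>1\},$$ $$J_Kf(x)=\int_{[\min K,x]\cap K}f\,d\lambda\quad(x\in K,\ f\in L^\infty(K)),\qquad \|f\|_A=\sup_{x\in K}|J_Kf(x)|.$$ A gap of $K$ is an open interval $(\ell,r)$, $\ell<r$, with $\ell,r\in K$ and $(\ell,r)\cap K=\emptyset$. A lipeomorphism is a bi-Lipschitz homeomorphism. Let $K,M\subseteq\mathbb R$ be compact sets of positive measure and let $\psi:[0,|M|]\to[0,|K|]$ be an increasing lipeomorphism. $K$ and $M$ are called fiber $\psi$-compatible if $\psi(E_M)=E_K$ and, for every $s\in E_M$, the fibers $\pi_M^{-1}(s)$ and $\pi_K^{-1}(\psi(s))$ are order-isomorphic. They are called gap $\psi$-compatible if they are fiber $\psi$-compatible and there are order-isomorphisms $h_s:\pi_M^{-1}(s)\to\pi_K^{-1}(\psi(s))$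 $(s\in E_M)$ and a constant $C\ge1$ such that for every gap $U=(\ell',r')$ of $M$, with $s=\pi_M(\ell')=\pi_M(r')$, $$C^{-1}\le\frac{\lambda(V_{U,h_s})}{\lambda(U)}\le C,\qquad V_{U,h_s}=(h_s(\ell'),h_s(r')).$$ **Corollary 5.5.** Assume that $K$ and $M$ are gap $\psi$-compatible. Let $T:(L^\infty(K),\|\cdot\|_A)\to(L^\infty(M),\|\cdot\|_A)$ be a surjective linear isometry associated to $\psi$, that is, such that for some sign $\varepsilon_0\in\{\pm1\}$ one has $J_M(Tf)=\varepsilon_0\,(J_Kf)\circ\sigma_K\circ\psi\circ\pi_M$ on $M$ for every $f\in L^\infty(K)$. Then there exist $\varepsilon\in\{\pm1\}$ and an increasing lipeomorphism $\phi:M\to K$ with $\pi_K\circ\phi=\psi\circ\pi_M$ such that, for every $f\in L^\infty(K)$, $$(Tf)(y)=\varepsilon\,f(\phi(y))\,\tilde\phi'(y)\qquad\text{for a.e. }y\in M,$$ where $\tilde\phi:[\min M,\max M]\to[\min K,\max K]$ denotes the extension of $\phi$ which is affine on each gap of $M$; in particular, $\tilde\phi$ is differentiable at a.e. $y\in M$.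 -/

import Mathlib

open Set MeasureTheory

namespace Alexiewicz

noncomputable section

/-- The measure projection `π_K(x) = λ([min K, x] ∩ K)`. For nonempty compact `K`, `sInf K` and
`sSup K` are the minimum and the maximum of `K`. -/
def proj (K : Set ℝ) (x : ℝ) : ℝ := volume.real (Icc (sInf K) x ∩ K)

/-- The fiber `π_K⁻¹(t)`, a subset of `K`. -/
def fiber (K : Set ℝ) (t : ℝ) : Set ℝ := {x | x ∈ K ∧ proj K x = t}

/-- The selector `σ_K(t) = min π_K⁻¹(t)`. -/
def selector (K : Set ℝ) (t : ℝ) : ℝ := sInf (fiber K t)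

/-- The set `E_K` of those `t ∈ [0, |K|]` whose fiber has more than one point. -/
def excSet (K : Set ℝ) : Set ℝ := {t | t ∈ Icc 0 (volume.real K) ∧ (fiber K t).Nontrivial}

/-- The open interval `(l, r)` is a gap of `K`. -/
structure IsGap (K : Set ℝ) (l r : ℝ) : Prop where
  lt : l < r
  left_mem : l ∈ K
  right_mem : r ∈ K
  disjoint : Disjoint (Ioo l r) K

/-- `φ` restricts to an increasing bi-Lipschitz bijection (an increasing lipeomorphism)
from `A` onto `B`. Values of `φ` outside `A` are irrelevant. -/
structure IsIncreasingLipeo (φ : ℝ → ℝ) (A B : Set ℝ) : Prop where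
  bijOn : BijOn φ A B
  strictMonoOn : StrictMonoOn φ A
  lipschitz : ∃ L : NNReal, LipschitzOnWith L φ A
  inv_lipschitz : ∃ L : NNReal, ∀ x ∈ A, ∀ y ∈ A, |x - y| ≤ L * |φ x - φ y|

/-- `K` and `M` are fiber `ψ`-compatible. -/
def FiberCompatible (K M : Set ℝ) (ψ : ℝ → ℝ) : Prop :=
  ψ '' excSet M = excSet K ∧ ∀ s ∈ excSet M, Nonempty (fiber M s ≃o fiber K (ψ s))

/-- `K` and `M` are gap `ψ`-compatible. If `(l, r)` is a gap of `M` whose endpoints lie in the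
fiber over `s`, the corresponding gap of `K` via `h s` is `(h s l, h s r)`. -/
def GapCompatible (K M : Set ℝ) (ψ : ℝ → ℝ) : Prop :=
  FiberCompatible K M ψ ∧
  ∃ h : ∀ s : ℝ, s ∈ excSet M → (fiber M s ≃o fiber K (ψ s)),
  ∃ C : ℝ, 1 ≤ C ∧
    ∀ l r : ℝ, IsGap M l r →
    ∀ (s : ℝ) (hs : s ∈ excSet M) (hl : l ∈ fiber M s) (hr : r ∈ fiber M s),
      C⁻¹ ≤ volume.real (Ioo (h s hs ⟨l, hl⟩ : ℝ) (h s hs ⟨r, hr⟩ : ℝ)) / volume.real (Ioo l r) ∧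
      volume.real (Ioo (h s hs ⟨l, hl⟩ : ℝ) (h s hs ⟨r, hr⟩ : ℝ)) / volume.real (Ioo l r) ≤ C

/-- The real space `L^∞(K)` with respect to Lebesgue measure (as a vector space; the norm used
below is the Alexiewicz norm `normA`). -/
abbrev LInf (K : Set ℝ) : Type := Lp ℝ ⊤ (volume.restrict K)

/-- The primitive `J_K f(x) = ∫_{[min K, x] ∩ K} f dλ`. -/
def primitive (K : Set ℝ) (f : LInf K) (x : ℝ) : ℝ := ∫ t in Icc (sInf K) x ∩ K, f t

/-- The Alexiewicz norm `sup_{x ∈ K} |J_K f(x)|`. -/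
def normA (K : Set ℝ) (f : LInf K) : ℝ := ⨆ x : K, |primitive K f x|

/-- `T` is a surjective linear isometry from `(L^∞(K), ‖·‖_A)` onto `(L^∞(M), ‖·‖_A)`. -/
structure IsSurjIsometry (K M : Set ℝ) (T : LInf K →ₗ[ℝ] LInf M) : Prop where
  surjective : Function.Surjective T
  norm_map : ∀ f : LInf K, normA M (T f) = normA K f

/-- `T` is associated to `ψ`: for some sign `ε` one has
`J_M(T f) = ε (J_K f) ∘ (σ_K ∘ ψ ∘ π_M)` on `M` for every `f`. -/
def IsAssociated (K M : Set ℝ) (ψ : ℝ → ℝ) (T : LInf K →ₗ[ℝ] LInf M) : Prop :=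
  ∃ ε : ℝ, (ε = 1 ∨ ε = -1) ∧ ∀ f : LInf K, ∀ y ∈ M,
    primitive M (T f) y = ε * primitive K f (selector K (ψ (proj M y)))

open Classical in
/-- The extension of `φ : M → ℝ` to `[min M, max M]` which is affine on each gap of `M`: a point
`y ∉ M` lies in the gap `(l, r)` with `l = max (M ∩ (-∞, y])` and `r = min (M ∩ [y, ∞))`. -/
def gapAffineExt (M : Set ℝ) (φ : ℝ → ℝ) (y : ℝ) : ℝ :=
  if y ∈ M then φ y
  else
    φ (sSup (M ∩ Iic y)) +
      (y - sSup (M ∩ Iic y)) / (sInf (M ∩ Ici y) - sSup (M ∩ Iic y)) *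
        (φ (sInf (M ∩ Ici y)) - φ (sSup (M ∩ Iic y)))

theorem gapAffineExt_of_mem {M : Set ℝ} (φ : ℝ → ℝ) {y : ℝ} (hy : y ∈ M) :
    gapAffineExt M φ y = φ y := by
  simp [gapAffineExt, hy]

theorem gapAffineExt_of_gap {M : Set ℝ} (φ : ℝ → ℝ) {l r y : ℝ} (h : IsGap M l r)
    (hy : y ∈ Icc l r) :
    gapAffineExt M φ y = φ l + (y - l) / (r - l) * (φ r - φ l) := by
  have hne : r - l ≠ 0 := sub_ne_zero.mpr h.lt.ne'
  rcases eq_or_lt_of_le hy.1 with rfl | h1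
  · simp [gapAffineExt_of_mem φ h.left_mem]
  rcases eq_or_lt_of_le hy.2 with rfl | h2
  · rw [gapAffineExt_of_mem φ h.right_mem, div_self hne]; ring
  have hd : ∀ z ∈ M, ¬ (l < z ∧ z < r) := fun z hz hzz =>
    Set.disjoint_left.mp h.disjoint hzz hz
  have hyM : y ∉ M := fun hm => hd y hm ⟨h1, h2⟩
  have hl : sSup (M ∩ Iic y) = l := by
    refine IsGreatest.csSup_eq ⟨⟨h.left_mem, h1.le⟩, fun z hz => ?_⟩
    by_contra hc
    exact hd z hz.1 ⟨not_le.mp hc, lt_of_le_of_lt hz.2 h2⟩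
  have hr : sInf (M ∩ Ici y) = r := by
    refine IsLeast.csInf_eq ⟨⟨h.right_mem, h2.le⟩, fun z hz => ?_⟩
    by_contra hc
    exact hd z hz.1 ⟨lt_of_lt_of_le h1 hz.2, not_le.mp hc⟩
  simp [gapAffineExt, hyM, hl, hr]

end

end Alexiewicz

/-!
An increasing bijection `φ : M → K` over `ψ` is forced outside the exceptional fibers and is given
by the isomorphisms `h s` on them. It is bi-Lipschitz because the length of an interval `(x, y]`
with endpoints in `M` is the measure of its part in `M`, which `π_M` reads off, plus the total
length of the gaps of `M` between `x` and `y`: the measures of the parts in `M` and in `K` are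
compared by the Lipschitz constants of `ψ` and its inverse, the gaps by the constant of gap
compatibility.

Since `π_K ∘ φ = ψ ∘ π_M` and `J_K f` is constant on the fibers of `π_K`, the hypothesis on `T`
says `J_M (T f) = ε (J_K f) ∘ φ`. A change of variables turns the right side into the primitive of
`ε f ∘ φ` times the derivative of the gap-affine extension, and a function on `M` is determined
almost everywhere by its primitive.
-/

open scoped ENNReal NNReal

namespace Alexiewicz

section Gaps

variable {K M : Set ℝ} {φ θ : ℝ → ℝ} {x y z : ℝ}

theorem IsGap.right_le {l r : ℝ} (h : IsGap K l r) (hz : z ∈ K) (hlz : l < z) : r ≤ z :=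
  not_lt.1 fun hzr => disjoint_left.1 h.disjoint ⟨hlz, hzr⟩ hz

theorem IsGap.eq_of_mem {l r l' r' : ℝ} (h : IsGap K l r) (h' : IsGap K l' r')
    (hz : z ∈ Ioo l r) (hz' : z ∈ Ioo l' r') : l = l' ∧ r = r' := by
  have hlr' : l < r' := hz.1.trans hz'.2
  have hl'r : l' < r := hz'.1.trans hz.2
  exact ⟨le_antisymm (not_lt.1 fun hlt => (h'.right_le h.left_mem hlt).not_gt hlr')
      (not_lt.1 fun hlt => (h.right_le h'.left_mem hlt).not_gt hl'r),
    (h.right_le h'.right_mem hlr').antisymm (h'.right_le h.right_mem hl'r)⟩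

theorem isGap_image_iff (hφ : StrictMonoOn φ M) {l r : ℝ} (hl : l ∈ M) (hr : r ∈ M) :
    IsGap (φ '' M) (φ l) (φ r) ↔ IsGap M l r := by
  constructor
  · refine fun h => ⟨(hφ.lt_iff_lt hl hr).1 h.lt, hl, hr, disjoint_left.2 fun z hz hzM => ?_⟩
    exact disjoint_left.1 h.disjoint ⟨hφ hl hzM hz.1, hφ hzM hr hz.2⟩ (mem_image_of_mem φ hzM)
  · refine fun h => ⟨hφ hl hr h.lt, mem_image_of_mem φ hl, mem_image_of_mem φ hr,
      disjoint_left.2 ?_⟩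
    rintro _ hz ⟨w, hw, rfl⟩
    exact disjoint_left.1 h.disjoint
      ⟨(hφ.lt_iff_lt hl hw).1 hz.1, (hφ.lt_iff_lt hw hr).1 hz.2⟩ hw

/-- The gaps `(l, r)` of `K` with `x ≤ l` and `r ≤ y`, encoded by their pairs of endpoints. -/
def gapsBetween (K : Set ℝ) (x y : ℝ) : Set (ℝ × ℝ) :=
  {p | IsGap K p.1 p.2 ∧ x ≤ p.1 ∧ p.2 ≤ y}

theorem exists_mem_gapsBetween (hK : IsClosed K) (hx : x ∈ K) (hy : y ∈ K) (hz : z ∈ Icc x y)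
    (hzK : z ∉ K) : ∃ p ∈ gapsBetween K x y, z ∈ Ioo p.1 p.2 := by
  have hl : IsGreatest (K ∩ Iic z) (sSup (K ∩ Iic z)) :=
    (hK.inter isClosed_Iic).isGreatest_csSup ⟨x, hx, hz.1⟩ (bddAbove_Iic.mono inter_subset_right)
  have hr : IsLeast (K ∩ Ici z) (sInf (K ∩ Ici z)) :=
    (hK.inter isClosed_Ici).isLeast_csInf ⟨y, hy, hz.2⟩ (bddBelow_Ici.mono inter_subset_right)
  have hlz : sSup (K ∩ Iic z) < z := lt_of_le_of_ne hl.1.2 fun h => hzK (h ▸ hl.1.1)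
  have hzr : z < sInf (K ∩ Ici z) := lt_of_le_of_ne hr.1.2 fun h => hzK (h ▸ hr.1.1)
  refine ⟨(sSup (K ∩ Iic z), sInf (K ∩ Ici z)),
    ⟨⟨hlz.trans hzr, hl.1.1, hr.1.1, disjoint_left.2 fun w hw hwK => ?_⟩,
      hl.2 ⟨hx, hz.1⟩, hr.2 ⟨hy, hz.2⟩⟩, hlz, hzr⟩
  rcases le_total w z with hwz | hzw
  · exact (hl.2 ⟨hwK, hwz⟩).not_gt hw.1
  · exact (hr.2 ⟨hwK, hzw⟩).not_gt hw.2

theorem pairwiseDisjoint_gapsBetween :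
    (gapsBetween K x y).PairwiseDisjoint fun p => Ioo p.1 p.2 := fun _ hp _ hq hne =>
  disjoint_left.2 fun _ hz hz' => hne (Prod.ext_iff.2 (hp.1.eq_of_mem hq.1 hz hz'))

theorem countable_gapsBetween : (gapsBetween K x y).Countable :=
  pairwiseDisjoint_gapsBetween.countable_of_isOpen (fun _ _ => isOpen_Ioo)
    fun _ hp => nonempty_Ioo.2 hp.1.lt

theorem Ioc_sdiff_eq_biUnion_gapsBetween (hK : IsClosed K) (hx : x ∈ K) (hy : y ∈ K) :
    Ioc x y \ K = ⋃ p ∈ gapsBetween K x y, Ioo p.1 p.2 := by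
  refine subset_antisymm (fun z hz => ?_) (iUnion₂_subset fun p hp z hz => ?_)
  · exact mem_iUnion₂.2 <| by
      simpa only [exists_prop] using
        exists_mem_gapsBetween hK hx hy (Ioc_subset_Icc_self hz.1) hz.2
  · exact ⟨⟨hp.2.1.trans_lt hz.1, hz.2.le.trans hp.2.2⟩, disjoint_left.1 hp.1.disjoint hz⟩

theorem gapsBetween_image (hφ : StrictMonoOn φ M) (hx : x ∈ M) (hy : y ∈ M) :
    gapsBetween (φ '' M) (φ x) (φ y) = Prod.map φ φ '' gapsBetween M x y := by
  refine subset_antisymm ?_ ?_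
  · rintro ⟨_, _⟩ ⟨hgap, hxl, hry⟩
    obtain ⟨l, hl, rfl⟩ := hgap.left_mem
    obtain ⟨r, hr, rfl⟩ := hgap.right_mem
    exact ⟨(l, r), ⟨(isGap_image_iff hφ hl hr).1 hgap, (hφ.le_iff_le hx hl).1 hxl,
      (hφ.le_iff_le hr hy).1 hry⟩, rfl⟩
  · rintro _ ⟨⟨l, r⟩, ⟨hgap, hxl, hry⟩, rfl⟩
    exact ⟨(isGap_image_iff hφ hgap.left_mem hgap.right_mem).2 hgap,
      (hφ.le_iff_le hx hgap.left_mem).2 hxl, (hφ.le_iff_le hgap.right_mem hy).2 hry⟩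

theorem measure_Ioc_sdiff_image (μ : Measure ℝ) (hφ : StrictMonoOn φ M)
    (hφM : IsClosed (φ '' M)) (hx : x ∈ M) (hy : y ∈ M) :
    μ (Ioc (φ x) (φ y) \ φ '' M) = ∑' p : gapsBetween M x y, μ (Ioo (φ p.1.1) (φ p.1.2)) := by
  have hinj : InjOn (Prod.map φ φ) (gapsBetween M x y) := fun p hp q hq h =>
    Prod.ext (hφ.injOn hp.1.left_mem hq.1.left_mem (congrArg Prod.fst h))
      (hφ.injOn hp.1.right_mem hq.1.right_mem (congrArg Prod.snd h))
  rw [Ioc_sdiff_eq_biUnion_gapsBetween hφM (mem_image_of_mem φ hx) (mem_image_of_mem φ hy),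
    measure_biUnion countable_gapsBetween pairwiseDisjoint_gapsBetween
      fun _ _ => measurableSet_Ioo, gapsBetween_image hφ hx hy]
  exact tsum_image (fun p : ℝ × ℝ => μ (Ioo p.1 p.2)) hinj

theorem measure_Ioc_le_of_gaps {μ ν : Measure ℝ} (hφ : StrictMonoOn φ M) (hθ : StrictMonoOn θ M)
    (hφM : IsClosed (φ '' M)) (hθM : IsClosed (θ '' M)) {C D : ℝ≥0∞}
    (hgap : ∀ l r, IsGap M l r → μ (Ioo (φ l) (φ r)) ≤ C * ν (Ioo (θ l) (θ r)))
    (hx : x ∈ M) (hy : y ∈ M)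
    (hinter : μ (Ioc (φ x) (φ y) ∩ φ '' M) ≤ D * ν (Ioc (θ x) (θ y) ∩ θ '' M)) :
    μ (Ioc (φ x) (φ y)) ≤ max C D * ν (Ioc (θ x) (θ y)) := by
  have hsdiff : μ (Ioc (φ x) (φ y) \ φ '' M) ≤ C * ν (Ioc (θ x) (θ y) \ θ '' M) := by
    rw [measure_Ioc_sdiff_image μ hφ hφM hx hy, measure_Ioc_sdiff_image ν hθ hθM hx hy,
      ← ENNReal.tsum_mul_left]
    exact ENNReal.tsum_le_tsum fun p => hgap _ _ p.2.1
  rw [← measure_inter_add_sdiff (Ioc (φ x) (φ y)) hφM.measurableSet,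
    ← measure_inter_add_sdiff (Ioc (θ x) (θ y)) hθM.measurableSet, mul_add]
  gcongr
  · exact hinter.trans (by gcongr; exact le_max_right C D)
  · exact hsdiff.trans (by gcongr; exact le_max_left C D)

end Gaps

section Lipeo

variable {A B : Set ℝ} {φ θ : ℝ → ℝ}

theorem edist_eq_volume_Ioc {x y : ℝ} (hxy : x ≤ y) : edist x y = volume (Ioc x y) := by
  rw [edist_comm, edist_dist, Real.dist_eq, abs_of_nonneg (sub_nonneg.2 hxy), Real.volume_Ioc]

theorem forall_edist_le_iff_forall_volume_Ioc_le (hφ : MonotoneOn φ A) (hθ : MonotoneOn θ A)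
    {C : ℝ≥0} :
    (∀ x ∈ A, ∀ y ∈ A, edist (φ x) (φ y) ≤ C * edist (θ x) (θ y)) ↔
      ∀ x ∈ A, ∀ y ∈ A, volume (Ioc (φ x) (φ y)) ≤ C * volume (Ioc (θ x) (θ y)) := by
  constructor
  · intro h x hx y hy
    rcases le_total x y with hxy | hyx
    · rw [← edist_eq_volume_Ioc (hφ hx hy hxy), ← edist_eq_volume_Ioc (hθ hx hy hxy)]
      exact h x hx y hy
    · rw [Ioc_eq_empty (hφ hy hx hyx).not_gt, measure_empty]
      exact zero_le
  · intro h x hx y hy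
    wlog hxy : x ≤ y generalizing x y
    · rw [edist_comm, edist_comm (θ x)]
      exact this y hy x hx (le_of_not_ge hxy)
    · rw [edist_eq_volume_Ioc (hφ hx hy hxy), edist_eq_volume_Ioc (hθ hx hy hxy)]
      exact h x hx y hy

theorem edist_le_mul_edist_iff {a b c d : ℝ} {C : ℝ≥0} :
    edist a b ≤ C * edist c d ↔ |a - b| ≤ C * |c - d| := by
  rw [edist_nndist, edist_nndist, ← ENNReal.coe_mul, ENNReal.coe_le_coe, ← NNReal.coe_le_coe,
    NNReal.coe_mul, coe_nndist, coe_nndist, Real.dist_eq, Real.dist_eq]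

theorem isIncreasingLipeo_iff_volume_Ioc : IsIncreasingLipeo φ A B ↔
    BijOn φ A B ∧ StrictMonoOn φ A ∧
      (∃ C : ℝ≥0, ∀ x ∈ A, ∀ y ∈ A, volume (Ioc (φ x) (φ y)) ≤ C * volume (Ioc x y)) ∧
      ∃ C : ℝ≥0, ∀ x ∈ A, ∀ y ∈ A, volume (Ioc x y) ≤ C * volume (Ioc (φ x) (φ y)) := by
  constructor
  · rintro ⟨hb, hm, ⟨L, hL⟩, L', hL'⟩
    exact ⟨hb, hm,
      ⟨L, (forall_edist_le_iff_forall_volume_Ioc_le hm.monotoneOn monotoneOn_id).1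
        fun x hx y hy => hL hx hy⟩,
      L', (forall_edist_le_iff_forall_volume_Ioc_le monotoneOn_id hm.monotoneOn).1
        fun x hx y hy => edist_le_mul_edist_iff.2 (hL' x hx y hy)⟩
  · rintro ⟨hb, hm, ⟨L, hL⟩, L', hL'⟩
    exact ⟨hb, hm,
      ⟨L, fun x hx y hy =>
        (forall_edist_le_iff_forall_volume_Ioc_le hm.monotoneOn monotoneOn_id).2 hL x hx y hy⟩,
      L', fun x hx y hy => edist_le_mul_edist_iff.1
        ((forall_edist_le_iff_forall_volume_Ioc_le monotoneOn_id hm.monotoneOn).2 hL' x hx y hy)⟩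

theorem isIncreasingLipeo_of_gaps {K M : Set ℝ} (hK : IsClosed K) (hM : IsClosed M)
    (hb : BijOn φ M K) (hm : StrictMonoOn φ M) {C L L' : ℝ≥0}
    (hgap : ∀ l r, IsGap M l r → volume (Ioo (φ l) (φ r)) ≤ C * volume (Ioo l r))
    (hgap' : ∀ l r, IsGap M l r → volume (Ioo l r) ≤ C * volume (Ioo (φ l) (φ r)))
    (hinter : ∀ x ∈ M, ∀ y ∈ M, volume (Ioc (φ x) (φ y) ∩ K) ≤ L * volume (Ioc x y ∩ M))
    (hinter' : ∀ x ∈ M, ∀ y ∈ M, volume (Ioc x y ∩ M) ≤ L' * volume (Ioc (φ x) (φ y) ∩ K)) :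
    IsIncreasingLipeo φ M K := by
  have hid : StrictMonoOn id M := strictMono_id.strictMonoOn M
  have hidM : IsClosed (id '' M) := by rwa [image_id]
  obtain rfl : φ '' M = K := hb.image_eq
  refine isIncreasingLipeo_iff_volume_Ioc.2 ⟨hb, hm, ⟨max C L, fun x hx y hy => ?_⟩,
    max C L', fun x hx y hy => ?_⟩
  · rw [ENNReal.coe_max]
    exact measure_Ioc_le_of_gaps hm hid hK hidM hgap hx hy (by simpa using hinter x hx y hy)
  · rw [ENNReal.coe_max]
    exact measure_Ioc_le_of_gaps hid hm hidM hK hgap' hx hy (by simpa using hinter' x hx y hy)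

end Lipeo

section Projection

variable {K : Set ℝ} {x y t : ℝ}

theorem Icc_sInf_inter_eq (hK : BddBelow K) (x : ℝ) : Icc (sInf K) x ∩ K = Iic x ∩ K :=
  ext fun _ => ⟨fun h => ⟨h.1.2, h.2⟩, fun h => ⟨⟨csInf_le hK h.2, h.1⟩, h.2⟩⟩

theorem proj_eq_volume_Iic_inter (hK : BddBelow K) (x : ℝ) :
    proj K x = volume.real (Iic x ∩ K) := by
  rw [proj, Icc_sInf_inter_eq hK]

theorem proj_sub_proj (hK : BddBelow K) (hxy : x ≤ y) :
    proj K y - proj K x = volume.real (Ioc x y ∩ K) := by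
  have hfin : volume (Iic y ∩ K) ≠ ∞ := by
    rw [← Icc_sInf_inter_eq hK]
    exact measure_ne_top_of_subset inter_subset_left measure_Icc_lt_top.ne
  have hinter : Iic y ∩ K ∩ Iic x = Iic x ∩ K := by grind
  have hsdiff : (Iic y ∩ K) \ Iic x = Ioc x y ∩ K := by grind
  rw [sub_eq_iff_eq_add', proj_eq_volume_Iic_inter hK, proj_eq_volume_Iic_inter hK,
    ← measureReal_inter_add_sdiff (measurableSet_Iic (a := x)) hfin, hinter, hsdiff]

theorem monotone_proj (hK : BddBelow K) : Monotone (proj K) := fun _ _ hxy =>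
  sub_nonneg.1 ((proj_sub_proj hK hxy).symm ▸ measureReal_nonneg)

theorem lipschitzWith_proj (hK : BddBelow K) : LipschitzWith 1 (proj K) := by
  refine LipschitzWith.of_le_add fun x y => ?_
  rcases le_total x y with hxy | hyx
  · exact (monotone_proj hK hxy).trans (le_add_of_nonneg_right dist_nonneg)
  · rw [← sub_le_iff_le_add', proj_sub_proj hK hyx, Real.dist_eq, abs_of_nonneg (sub_nonneg.2 hyx),
      ← Real.volume_real_Ioc_of_le hyx]
    exact measureReal_mono inter_subset_left measure_Ioc_lt_top.ne

theorem volume_Ioc_proj (hK : BddBelow K) (x y : ℝ) :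
    volume (Ioc (proj K x) (proj K y)) = volume (Ioc x y ∩ K) := by
  rcases le_total x y with hxy | hyx
  · rw [Real.volume_Ioc, proj_sub_proj hK hxy,
      ofReal_measureReal (measure_ne_top_of_subset inter_subset_left measure_Ioc_lt_top.ne)]
  · rw [Ioc_eq_empty (monotone_proj hK hyx).not_gt, Ioc_eq_empty hyx.not_gt, empty_inter]

theorem proj_mem_Icc (hK : volume K ≠ ∞) (x : ℝ) : proj K x ∈ Icc 0 (volume.real K) :=
  ⟨measureReal_nonneg, measureReal_mono inter_subset_right hK⟩

theorem proj_sInf (K : Set ℝ) : proj K (sInf K) = 0 := by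
  rw [proj, Icc_self, measureReal_def, measure_mono_null inter_subset_left Real.volume_singleton,
    ENNReal.toReal_zero]

theorem proj_sSup (hK : Bornology.IsBounded K) : proj K (sSup K) = volume.real K := by
  rw [proj, inter_eq_right.2 hK.subset_Icc_sInf_sSup]

theorem exists_mem_Iic_inter_eq (hK : IsClosed K) (hne : (Iic x ∩ K).Nonempty) :
    ∃ y ∈ K, Iic y ∩ K = Iic x ∩ K := by
  have hmax : IsGreatest (Iic x ∩ K) (sSup (Iic x ∩ K)) :=
    (isClosed_Iic.inter hK).isGreatest_csSup hne (bddAbove_Iic.mono inter_subset_left)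
  exact ⟨_, hmax.1.2, ext fun z =>
    ⟨fun hz => ⟨Iic_subset_Iic.2 hmax.1.1 hz.1, hz.2⟩, fun hz => ⟨hmax.2 hz, hz.2⟩⟩⟩

theorem fiber_nonempty (hK : IsCompact K) (hne : K.Nonempty) (ht : t ∈ Icc 0 (volume.real K)) :
    (fiber K t).Nonempty := by
  have hle : sInf K ≤ sSup K := csInf_le_csSup hne hK.bddBelow hK.bddAbove
  rw [← proj_sInf K, ← proj_sSup hK.isBounded] at ht
  obtain ⟨x, hx, rfl⟩ :=
    intermediate_value_Icc hle (lipschitzWith_proj hK.bddBelow).continuous.continuousOn ht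
  obtain ⟨y, hy, hyx⟩ := exists_mem_Iic_inter_eq hK.isClosed ⟨sInf K, hx.1, hK.sInf_mem hne⟩
  refine ⟨y, hy, ?_⟩
  rw [proj_eq_volume_Iic_inter hK.bddBelow, hyx, proj_eq_volume_Iic_inter hK.bddBelow]

theorem selector_mem_fiber (hK : IsCompact K) (hne : (fiber K t).Nonempty) :
    selector K t ∈ fiber K t :=
  (hK.inter_right (isClosed_singleton.preimage
    (lipschitzWith_proj hK.bddBelow).continuous)).sInf_mem hne

theorem IsGap.proj_eq {l r : ℝ} (hK : BddBelow K) (h : IsGap K l r) : proj K l = proj K r := by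
  have hnull : volume (Ioc l r ∩ K) = 0 :=
    measure_mono_null (fun z hz => hz.1.2.antisymm (h.right_le hz.2 hz.1.1))
      (Real.volume_singleton (a := r))
  have hdiff := proj_sub_proj hK h.lt.le
  rw [measureReal_def, hnull, ENNReal.toReal_zero, sub_eq_zero] at hdiff
  exact hdiff.symm

theorem IsGap.mem_excSet {l r : ℝ} (hK : IsCompact K) (h : IsGap K l r) :
    proj K l ∈ excSet K :=
  ⟨proj_mem_Icc hK.measure_lt_top.ne l, l, ⟨h.left_mem, rfl⟩,
    r, ⟨h.right_mem, (h.proj_eq hK.bddBelow).symm⟩, h.lt.ne⟩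

end Projection

section Gluing

theorem exists_bijOn_strictMonoOn_of_fiberwise {α β γ δ : Type*} [LinearOrder α] [LinearOrder β]
    [Nonempty β] [PartialOrder γ] [Preorder δ] {M : Set α} {K : Set β} {S : Set γ} {p : α → γ}
    {q : β → δ} {ψ : γ → δ} (hp : MonotoneOn p M) (hq : MonotoneOn q K) (hψ : StrictMonoOn ψ S)
    (hpS : MapsTo p M S) (hqS : MapsTo q K (ψ '' S))
    (h : ∀ s ∈ S, {x | x ∈ M ∧ p x = s} ≃o {x | x ∈ K ∧ q x = ψ s}) :
    ∃ φ : α → β, BijOn φ M K ∧ StrictMonoOn φ M ∧ (∀ x ∈ M, q (φ x) = ψ (p x)) ∧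
      ∀ s (hs : s ∈ S) x (hx : x ∈ {x | x ∈ M ∧ p x = s}), φ x = h s hs ⟨x, hx⟩ := by
  classical
  let φ : α → β := fun x =>
    if hx : x ∈ M then h (p x) (hpS hx) ⟨x, hx, rfl⟩ else Classical.arbitrary β
  have hφ : ∀ s (hs : s ∈ S) x (hx : x ∈ {x | x ∈ M ∧ p x = s}), φ x = h s hs ⟨x, hx⟩ := by
    rintro _ _ x ⟨hx, rfl⟩
    exact dif_pos hx
  have hmem : ∀ x ∈ M, φ x ∈ K ∧ q (φ x) = ψ (p x) := fun x hx => by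
    rw [hφ (p x) (hpS hx) x ⟨hx, rfl⟩]
    exact (h (p x) (hpS hx) ⟨x, hx, rfl⟩).2
  have hmono : StrictMonoOn φ M := by
    intro x hx y hy hxy
    rcases (hp hx hy hxy.le).eq_or_lt with heq | hlt
    · rw [hφ (p y) (hpS hy) x ⟨hx, heq⟩, hφ (p y) (hpS hy) y ⟨hy, rfl⟩]
      exact (h _ _).strictMono hxy
    · refine hq.reflect_lt (hmem x hx).1 (hmem y hy).1 ?_
      rw [(hmem x hx).2, (hmem y hy).2]
      exact hψ (hpS hx) (hpS hy) hlt
  refine ⟨φ, ⟨fun x hx => (hmem x hx).1, hmono.injOn, fun z hz => ?_⟩, hmono,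
    fun x hx => (hmem x hx).2, hφ⟩
  obtain ⟨s, hs, hsz⟩ := hqS hz
  obtain ⟨⟨x, hx⟩, hxz⟩ := (h s hs).surjective ⟨z, hz, hsz.symm⟩
  exact ⟨x, hx.1, by rw [hφ s hs x hx, hxz]⟩

variable {K M : Set ℝ} {ψ : ℝ → ℝ}

theorem exists_fiber_eq_singleton (hK : IsCompact K) (hne : K.Nonempty) {t : ℝ}
    (ht : t ∈ Icc 0 (volume.real K)) (htK : t ∉ excSet K) : ∃ x, fiber K t = {x} :=
  exists_eq_singleton_iff_nonempty_subsingleton.2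
    ⟨fiber_nonempty hK hne ht, not_nontrivial_iff.1 fun hnt => htK ⟨ht, hnt⟩⟩

theorem nonempty_fiber_orderIso_of_notMem_excSet (hK : IsCompact K) (hM : IsCompact M)
    (hKne : K.Nonempty) (hMne : M.Nonempty)
    (hψ : BijOn ψ (Icc 0 (volume.real M)) (Icc 0 (volume.real K)))
    (hE : ψ '' excSet M = excSet K) {s : ℝ} (hs : s ∈ Icc 0 (volume.real M))
    (hsM : s ∉ excSet M) : Nonempty (fiber M s ≃o fiber K (ψ s)) := by
  have hsK : ψ s ∉ excSet K := by
    rwa [← hE, hψ.injOn.mem_image_iff (fun _ ht => ht.1) hs]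
  obtain ⟨x, hx⟩ := exists_fiber_eq_singleton hM hMne hs hsM
  obtain ⟨y, hy⟩ := exists_fiber_eq_singleton hK hKne (hψ.mapsTo hs) hsK
  rw [hx, hy]
  exact ⟨OrderIso.ofUnique _ _⟩

theorem exists_bijOn_strictMonoOn_of_fiberOrderIso (hK : IsCompact K) (hM : IsCompact M)
    (hKne : K.Nonempty) (hMne : M.Nonempty)
    (hψ : BijOn ψ (Icc 0 (volume.real M)) (Icc 0 (volume.real K)))
    (hψm : StrictMonoOn ψ (Icc 0 (volume.real M))) (hE : ψ '' excSet M = excSet K)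
    (h : ∀ s, s ∈ excSet M → (fiber M s ≃o fiber K (ψ s))) :
    ∃ φ : ℝ → ℝ, BijOn φ M K ∧ StrictMonoOn φ M ∧ (∀ y ∈ M, proj K (φ y) = ψ (proj M y)) ∧
      ∀ s (hs : s ∈ excSet M) y (hy : y ∈ fiber M s), φ y = h s hs ⟨y, hy⟩ := by
  classical
  let H : ∀ s ∈ Icc 0 (volume.real M), fiber M s ≃o fiber K (ψ s) := fun s hs =>
    if hsM : s ∈ excSet M then h s hsM
    else (nonempty_fiber_orderIso_of_notMem_excSet hK hM hKne hMne hψ hE hs hsM).some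
  obtain ⟨φ, hb, hm, hp, hφ⟩ := exists_bijOn_strictMonoOn_of_fiberwise
    ((monotone_proj hM.bddBelow).monotoneOn M) ((monotone_proj hK.bddBelow).monotoneOn K) hψm
    (fun y _ => proj_mem_Icc hM.measure_lt_top.ne y)
    (fun x _ => hψ.image_eq.symm ▸ proj_mem_Icc hK.measure_lt_top.ne x) H
  refine ⟨φ, hb, hm, hp, fun s hs y hy => ?_⟩
  have hHs : H s hs.1 = h s hs := dif_pos hs
  rw [← hHs]
  exact hφ s hs.1 y hy

theorem measure_le_mul_of_measureReal_div_le {α : Type*} [MeasurableSpace α] {μ : Measure α}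
    {s t : Set α} (hs : μ s ≠ ∞) (ht : 0 < μ.real t) {C : ℝ≥0} (h : μ.real s / μ.real t ≤ C) :
    μ s ≤ C * μ t := by
  calc μ s = ENNReal.ofReal (μ.real s) := (ofReal_measureReal hs).symm
    _ ≤ ENNReal.ofReal (C * μ.real t) := ENNReal.ofReal_le_ofReal ((div_le_iff₀ ht).1 h)
    _ = C * ENNReal.ofReal (μ.real t) := by
      rw [ENNReal.ofReal_mul C.coe_nonneg, ENNReal.ofReal_coe_nnreal]
    _ ≤ C * μ t := by
      gcongr
      exact ENNReal.ofReal_toReal_le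

theorem GapCompatible.exists_bijOn_strictMonoOn (hK : IsCompact K) (hM : IsCompact M)
    (hKne : K.Nonempty) (hMne : M.Nonempty)
    (hψ : BijOn ψ (Icc 0 (volume.real M)) (Icc 0 (volume.real K)))
    (hψm : StrictMonoOn ψ (Icc 0 (volume.real M))) (h : GapCompatible K M ψ) :
    ∃ φ : ℝ → ℝ, BijOn φ M K ∧ StrictMonoOn φ M ∧ (∀ y ∈ M, proj K (φ y) = ψ (proj M y)) ∧
      ∃ C : ℝ≥0, ∀ l r, IsGap M l r →
        volume (Ioo (φ l) (φ r)) ≤ C * volume (Ioo l r) ∧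
          volume (Ioo l r) ≤ C * volume (Ioo (φ l) (φ r)) := by
  obtain ⟨⟨hE, -⟩, h, C, hC, hgap⟩ := h
  obtain ⟨φ, hb, hm, hp, hφ⟩ :=
    exists_bijOn_strictMonoOn_of_fiberOrderIso hK hM hKne hMne hψ hψm hE h
  lift C to ℝ≥0 using zero_le_one.trans hC
  refine ⟨φ, hb, hm, hp, C, fun l r hlr => ?_⟩
  have hs := hlr.mem_excSet hM
  have hl : l ∈ fiber M (proj M l) := ⟨hlr.left_mem, rfl⟩
  have hr : r ∈ fiber M (proj M l) := ⟨hlr.right_mem, (hlr.proj_eq hM.bddBelow).symm⟩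
  have hpos {a b : ℝ} (hab : a < b) : 0 < volume.real (Ioo a b) := by
    rw [Real.volume_real_Ioo_of_le hab.le]
    exact sub_pos.2 hab
  obtain ⟨hlower, hupper⟩ := hgap l r hlr _ hs hl hr
  rw [← hφ _ hs l hl, ← hφ _ hs r hr] at hlower hupper
  refine ⟨measure_le_mul_of_measureReal_div_le measure_Ioo_lt_top.ne (hpos hlr.lt) hupper,
    measure_le_mul_of_measureReal_div_le measure_Ioo_lt_top.ne
      (hpos (hm hlr.left_mem hlr.right_mem hlr.lt)) ?_⟩
  rw [← inv_div]
  exact inv_le_of_inv_le₀ (zero_lt_one.trans_le hC) hlower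

theorem GapCompatible.exists_isIncreasingLipeo (hK : IsCompact K) (hM : IsCompact M)
    (hKne : K.Nonempty) (hMne : M.Nonempty)
    (hψ : IsIncreasingLipeo ψ (Icc 0 (volume.real M)) (Icc 0 (volume.real K)))
    (h : GapCompatible K M ψ) :
    ∃ φ : ℝ → ℝ, IsIncreasingLipeo φ M K ∧ ∀ y ∈ M, proj K (φ y) = ψ (proj M y) := by
  obtain ⟨φ, hb, hm, hp, C, hgap⟩ :=
    h.exists_bijOn_strictMonoOn hK hM hKne hMne hψ.bijOn hψ.strictMonoOn
  obtain ⟨-, -, ⟨L, hL⟩, L', hL'⟩ := isIncreasingLipeo_iff_volume_Ioc.1 hψ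
  have hvol : ∀ x ∈ M, ∀ y ∈ M, volume (Ioc (φ x) (φ y) ∩ K) =
      volume (Ioc (ψ (proj M x)) (ψ (proj M y))) := fun x hx y hy => by
    rw [← volume_Ioc_proj hK.bddBelow, hp x hx, hp y hy]
  have hmem := proj_mem_Icc hM.measure_lt_top.ne
  refine ⟨φ, isIncreasingLipeo_of_gaps (L := L) (L' := L') hK.isClosed hM.isClosed hb hm
    (fun l r hlr => (hgap l r hlr).1) (fun l r hlr => (hgap l r hlr).2)
    (fun x hx y hy => ?_) (fun x hx y hy => ?_), hp⟩
  · rw [hvol x hx y hy, ← volume_Ioc_proj hM.bddBelow]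
    exact hL _ (hmem x) _ (hmem y)
  · rw [hvol x hx y hy, ← volume_Ioc_proj hM.bddBelow]
    exact hL' _ (hmem x) _ (hmem y)

end Gluing

section GapAffineExt

variable {M : Set ℝ} {φ : ℝ → ℝ} {x y : ℝ}

theorem gapAffineExt_eqOn (M : Set ℝ) (φ : ℝ → ℝ) : EqOn (gapAffineExt M φ) φ M := fun _ hy =>
  gapAffineExt_of_mem φ hy

theorem IsGap.monotoneOn_gapAffineExt {l r : ℝ} (h : IsGap M l r) (hφ : φ l ≤ φ r) :
    MonotoneOn (gapAffineExt M φ) (Icc l r) := fun x hx y hy hxy => by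
  have hdiv : (x - l) / (r - l) ≤ (y - l) / (r - l) :=
    div_le_div_of_nonneg_right (sub_le_sub_right hxy l) (sub_nonneg.2 h.lt.le)
  rw [gapAffineExt_of_gap φ h hx, gapAffineExt_of_gap φ h hy]
  exact add_le_add_right (mul_le_mul_of_nonneg_right hdiv (sub_nonneg.2 hφ)) (φ l)

theorem le_gapAffineExt (hM : IsCompact M) (hφ : MonotoneOn φ M) (hx : x ∈ M) (hxy : x ≤ y)
    (hy : y ≤ sSup M) : φ x ≤ gapAffineExt M φ y := by
  by_cases hyM : y ∈ M
  · rw [gapAffineExt_of_mem φ hyM]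
    exact hφ hx hyM hxy
  · obtain ⟨⟨l, r⟩, ⟨hlr, hxl, -⟩, hy⟩ :=
      exists_mem_gapsBetween hM.isClosed hx (hM.sSup_mem ⟨x, hx⟩) ⟨hxy, hy⟩ hyM
    calc φ x ≤ φ l := hφ hx hlr.left_mem hxl
      _ = gapAffineExt M φ l := (gapAffineExt_of_mem φ hlr.left_mem).symm
      _ ≤ gapAffineExt M φ y := hlr.monotoneOn_gapAffineExt
        (hφ hlr.left_mem hlr.right_mem hlr.lt.le) (left_mem_Icc.2 hlr.lt.le)
        (Ioo_subset_Icc_self hy) hy.1.le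

theorem monotoneOn_gapAffineExt (hM : IsCompact M) (hne : M.Nonempty) (hφ : MonotoneOn φ M) :
    MonotoneOn (gapAffineExt M φ) (Icc (sInf M) (sSup M)) := by
  intro x hx y hy hxy
  by_cases hxM : x ∈ M
  · rw [gapAffineExt_of_mem φ hxM]
    exact le_gapAffineExt hM hφ hxM hxy hy.2
  obtain ⟨⟨l, r⟩, ⟨hlr, -, -⟩, hxlr⟩ :=
    exists_mem_gapsBetween hM.isClosed (hM.sInf_mem hne) (hM.sSup_mem hne) hx hxM
  have hmono := hlr.monotoneOn_gapAffineExt (hφ hlr.left_mem hlr.right_mem hlr.lt.le)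
  have hxlr : x ∈ Icc l r := Ioo_subset_Icc_self hxlr
  rcases le_total y r with hyr | hry
  · exact hmono hxlr ⟨hxlr.1.trans hxy, hyr⟩ hxy
  · calc gapAffineExt M φ x ≤ gapAffineExt M φ r :=
        hmono hxlr (right_mem_Icc.2 hlr.lt.le) hxlr.2
      _ = φ r := gapAffineExt_of_mem φ hlr.right_mem
      _ ≤ gapAffineExt M φ y := le_gapAffineExt hM hφ hlr.right_mem hry hy.2

theorem mapsTo_gapAffineExt (hM : IsCompact M) (hne : M.Nonempty) (hφ : MonotoneOn φ M) :
    MapsTo (gapAffineExt M φ) (Icc (sInf M) (sSup M)) (Icc (φ (sInf M)) (φ (sSup M))) := by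
  have hmaps := (monotoneOn_gapAffineExt hM hne hφ).mapsTo_Icc
  rwa [gapAffineExt_of_mem φ (hM.sInf_mem hne), gapAffineExt_of_mem φ (hM.sSup_mem hne)] at hmaps

theorem ae_differentiableAt_of_monotoneOn_Icc {f : ℝ → ℝ} {a b : ℝ}
    (hf : MonotoneOn f (Icc a b)) :
    ∀ᵐ x ∂volume.restrict (Icc a b), DifferentiableAt ℝ f x := by
  rw [← Measure.restrict_congr_set Ioo_ae_eq_Icc, ae_restrict_iff' measurableSet_Ioo]
  filter_upwards [hf.ae_differentiableWithinAt_of_mem] with x hx hxab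
  exact (hx (Ioo_subset_Icc_self hxab)).differentiableAt (Icc_mem_nhds hxab.1 hxab.2)

theorem ae_differentiableAt_gapAffineExt (hM : IsCompact M) (hφ : MonotoneOn φ M) :
    ∀ᵐ y ∂volume.restrict M, DifferentiableAt ℝ (gapAffineExt M φ) y := by
  rcases M.eq_empty_or_nonempty with rfl | hne
  · simp
  · exact ae_restrict_of_ae_restrict_of_subset hM.isBounded.subset_Icc_sInf_sSup
      (ae_differentiableAt_of_monotoneOn_Icc (monotoneOn_gapAffineExt hM hne hφ))

end GapAffineExt

section ChangeOfVariables

variable {E : Type*} [NormedAddCommGroup E] [NormedSpace ℝ E] {φ φ' : ℝ → ℝ} {s t : Set ℝ}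
  {L : ℝ≥0}

theorem exists_measurableSet_subset_ae_eq {α : Type*} [MeasurableSpace α] {μ : Measure α}
    {s : Set α} (hs : MeasurableSet s) {p : α → Prop} (h : ∀ᵐ x ∂μ.restrict s, p x) :
    ∃ t ⊆ s, MeasurableSet t ∧ t =ᵐ[μ] s ∧ ∀ x ∈ t, p x := by
  obtain ⟨t, htae, htm, ht⟩ := h.exists_measurable_mem
  refine ⟨s ∩ t, inter_subset_left, hs.inter htm, ?_, fun x hx => ht x hx.2⟩
  filter_upwards [(ae_restrict_iff' hs).1 htae] with x hx
  exact propext (and_iff_left_of_imp hx)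

theorem volume_image_eq_zero (hφ : LipschitzOnWith L φ s) (hs : volume s = 0) :
    volume (φ '' s) = 0 := by
  have hle := hφ.hausdorffMeasure_image_le zero_le_one
  rw [hausdorffMeasure_real, hs, mul_zero] at hle
  exact nonpos_iff_eq_zero.1 hle

theorem image_ae_eq_image (hφ : LipschitzOnWith L φ s) (hts : t ⊆ s) (ht : t =ᵐ[volume] s) :
    φ '' t =ᵐ[volume] φ '' s :=
  (LE.le.eventuallyLE (image_mono hts)).antisymm <| ae_le_set.2 <|
    measure_mono_null (sdiff_subset_iff.2 (by rw [← image_union, union_sdiff_cancel hts]))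
      (volume_image_eq_zero (hφ.mono sdiff_subset) (ae_le_set.1 ht.symm.le))

theorem integrableOn_image_iff_integrableOn_smul_of_ae (hs : MeasurableSet s)
    (hmono : MonotoneOn φ s) (hφ : LipschitzOnWith L φ s)
    (hφ' : ∀ᵐ x ∂volume.restrict s, HasDerivWithinAt φ (φ' x) s x) (g : ℝ → E) :
    IntegrableOn g (φ '' s) ↔ IntegrableOn (fun x => φ' x • g (φ x)) s := by
  obtain ⟨t, hts, htm, hae, ht⟩ := exists_measurableSet_subset_ae_eq hs hφ'
  rw [← integrableOn_congr_set_ae hae, ← integrableOn_congr_set_ae (image_ae_eq_image hφ hts hae)]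
  exact integrableOn_image_iff_integrableOn_deriv_smul_of_monotoneOn htm
    (fun x hx => (ht x hx).mono hts) (hmono.mono hts) g

theorem setIntegral_image_eq_setIntegral_smul_of_ae (hs : MeasurableSet s)
    (hmono : MonotoneOn φ s) (hφ : LipschitzOnWith L φ s)
    (hφ' : ∀ᵐ x ∂volume.restrict s, HasDerivWithinAt φ (φ' x) s x) (g : ℝ → E) :
    ∫ x in φ '' s, g x = ∫ x in s, φ' x • g (φ x) := by
  obtain ⟨t, hts, htm, hae, ht⟩ := exists_measurableSet_subset_ae_eq hs hφ'
  rw [← setIntegral_congr_set hae, ← setIntegral_congr_set (image_ae_eq_image hφ hts hae)]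
  exact integral_image_eq_integral_deriv_smul_of_monotoneOn htm
    (fun x hx => (ht x hx).mono hts) (hmono.mono hts) g

end ChangeOfVariables

section Uniqueness

variable {E : Type*} [NormedAddCommGroup E] [NormedSpace ℝ E] [CompleteSpace E] {M : Set ℝ}

theorem ae_eq_zero_of_setIntegral_Iic {f : ℝ → E} (hf : Integrable f)
    (h : ∀ y, ∫ x in Iic y, f x = 0) : f =ᵐ[volume] 0 := by
  have hzero : ∀ y, ∫ x in (0 : ℝ)..y, f x = 0 := fun y => by
    rw [← intervalIntegral.integral_Iic_sub_Iic hf.integrableOn hf.integrableOn, h, h, sub_zero]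
  filter_upwards [LocallyIntegrable.ae_hasDerivAt_integral hf.locallyIntegrable] with x hx
  have hderiv := hx 0
  simp only [hzero] at hderiv
  exact hderiv.unique (hasDerivAt_const x 0)

theorem ae_eq_of_setIntegral_Iic_inter_eq (hM : IsClosed M) {u v : ℝ → E}
    (hu : IntegrableOn u M) (hv : IntegrableOn v M)
    (h : ∀ y ∈ M, ∫ x in Iic y ∩ M, u x = ∫ x in Iic y ∩ M, v x) :
    u =ᵐ[volume.restrict M] v := by
  have hsub : ∀ y, ∫ x in Iic y, M.indicator (u - v) x = 0 := fun y => by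
    rw [setIntegral_indicator hM.measurableSet]
    rcases (Iic y ∩ M).eq_empty_or_nonempty with hempty | hne
    · rw [hempty, setIntegral_empty]
    · obtain ⟨z, hz, hzy⟩ := exists_mem_Iic_inter_eq hM hne
      rw [← hzy, integral_sub' (hu.mono_set inter_subset_right) (hv.mono_set inter_subset_right),
        h z hz, sub_self]
  have hzero := ae_eq_zero_of_setIntegral_Iic
    ((hu.sub hv).integrable_indicator hM.measurableSet) hsub
  exact (sub_ae_eq_zero u v).1
    ((indicator_ae_eq_restrict hM.measurableSet).symm.trans (ae_restrict_of_ae hzero))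

theorem image_Iic_inter {α β : Type*} [LinearOrder α] [Preorder β] {φ : α → β} {M : Set α}
    (hφ : StrictMonoOn φ M) {y : α} (hy : y ∈ M) : φ '' (Iic y ∩ M) = Iic (φ y) ∩ φ '' M := by
  refine subset_antisymm ?_ ?_
  · rintro _ ⟨x, ⟨hxy, hx⟩, rfl⟩
    exact ⟨(hφ.le_iff_le hx hy).2 hxy, mem_image_of_mem φ hx⟩
  · rintro _ ⟨hxy, x, hx, rfl⟩
    exact ⟨x, ⟨(hφ.le_iff_le hx hy).1 hxy, hx⟩, rfl⟩

theorem ae_eq_smul_comp_of_setIntegral_Iic_eq (hM : IsClosed M) {φ φ' : ℝ → ℝ} {L : ℝ≥0}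
    (hmono : StrictMonoOn φ M) (hφ : LipschitzOnWith L φ M)
    (hφ' : ∀ᵐ y ∂volume.restrict M, HasDerivWithinAt φ (φ' y) M y) {k g : ℝ → E}
    (hk : IntegrableOn k M) (hg : IntegrableOn g (φ '' M))
    (h : ∀ y ∈ M, ∫ x in Iic y ∩ M, k x = ∫ x in Iic (φ y) ∩ φ '' M, g x) :
    k =ᵐ[volume.restrict M] fun y => φ' y • g (φ y) := by
  refine ae_eq_of_setIntegral_Iic_inter_eq hM hk
    ((integrableOn_image_iff_integrableOn_smul_of_ae hM.measurableSet hmono.monotoneOn hφ hφ' g).1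
      hg) fun y hy => ?_
  have hsub : Iic y ∩ M ⊆ M := inter_subset_right
  rw [h y hy, ← image_Iic_inter hmono hy]
  refine setIntegral_image_eq_setIntegral_smul_of_ae (measurableSet_Iic.inter hM.measurableSet)
    (hmono.monotoneOn.mono hsub) (hφ.mono hsub) ?_ g
  filter_upwards [ae_restrict_of_ae_restrict_of_subset hsub hφ'] with x hx using hx.mono hsub

end Uniqueness

section Primitive

variable {K M : Set ℝ}

theorem primitive_eq_setIntegral_Iic (hK : BddBelow K) (f : LInf K) (x : ℝ) :
    primitive K f x = ∫ t in Iic x ∩ K, f t := by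
  rw [primitive, Icc_sInf_inter_eq hK]

theorem primitive_congr (hK : BddBelow K) (f : LInf K) {x y : ℝ} (h : proj K x = proj K y) :
    primitive K f x = primitive K f y := by
  wlog hxy : x ≤ y generalizing x y
  · exact (this h.symm (le_of_not_ge hxy)).symm
  have hnull : volume (Ioc x y ∩ K) = 0 := by
    rw [← volume_Ioc_proj hK, h, Ioc_self, measure_empty]
  rw [primitive_eq_setIntegral_Iic hK, primitive_eq_setIntegral_Iic hK,
    ← Iic_union_Ioc_eq_Iic hxy, union_inter_distrib_right]
  exact (setIntegral_congr_set (union_ae_eq_left_of_ae_eq_empty (ae_eq_empty.2 hnull))).symm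

theorem primitive_selector (hK : IsCompact K) (f : LInf K) {x : ℝ} (hx : x ∈ K) :
    primitive K f (selector K (proj K x)) = primitive K f x :=
  primitive_congr hK.bddBelow f (selector_mem_fiber hK ⟨x, hx, rfl⟩).2

theorem integrableOn_lInf (hK : volume K ≠ ∞) (f : LInf K) : IntegrableOn f K :=
  have := isFiniteMeasure_restrict.2 hK
  (Lp.memLp f).integrable le_top

theorem ae_eq_mul_comp_mul_of_primitive_eq (hK : IsCompact K) (hM : IsCompact M) {φ φ' : ℝ → ℝ}
    (hφ : IsIncreasingLipeo φ M K)
    (hφ' : ∀ᵐ y ∂volume.restrict M, HasDerivWithinAt φ (φ' y) M y) {c : ℝ} {f : LInf K}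
    {k : LInf M} (h : ∀ y ∈ M, primitive M k y = c * primitive K f (φ y)) {g : ℝ → ℝ}
    (hg : g =ᵐ[volume.restrict K] f) :
    ∀ᵐ y ∂volume.restrict M, k y = c * g (φ y) * φ' y := by
  obtain ⟨L, hL⟩ := hφ.lipschitz
  have hgint : IntegrableOn g K := (integrableOn_lInf hK.measure_lt_top.ne f).congr hg.symm
  have hprim : ∀ y ∈ M, ∫ x in Iic y ∩ M, k x = ∫ x in Iic (φ y) ∩ φ '' M, c * g x :=
    fun y hy => by
      rw [← primitive_eq_setIntegral_Iic hM.bddBelow, h y hy,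
        primitive_eq_setIntegral_Iic hK.bddBelow, hφ.bijOn.image_eq, integral_const_mul,
        integral_congr_ae (ae_restrict_of_ae_restrict_of_subset inter_subset_right hg)]
  filter_upwards [ae_eq_smul_comp_of_setIntegral_Iic_eq hM.isClosed hφ.strictMonoOn hL hφ'
    (integrableOn_lInf hM.measure_lt_top.ne k)
    (hφ.bijOn.image_eq.symm ▸ hgint.const_mul c) hprim] with y hy
  rw [hy, smul_eq_mul, mul_comm]

end Primitive

end Alexiewicz

theorem corollary5p5 (K M : Set ℝ) (hK : IsCompact K) (hM : IsCompact M)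
    (hK0 : 0 < volume K) (hM0 : 0 < volume M)
    (ψ : ℝ → ℝ)
    (hψ : Alexiewicz.IsIncreasingLipeo ψ (Icc 0 (volume.real M)) (Icc 0 (volume.real K)))
    (hgap : Alexiewicz.GapCompatible K M ψ)
    (T : Alexiewicz.LInf K →ₗ[ℝ] Alexiewicz.LInf M)
    (hT : Alexiewicz.IsSurjIsometry K M T)
    (hTψ : Alexiewicz.IsAssociated K M ψ T) :
    ∃ (ε : ℝ) (φ : ℝ → ℝ), (ε = 1 ∨ ε = -1) ∧
      Alexiewicz.IsIncreasingLipeo φ M K ∧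
      (∀ y ∈ M, Alexiewicz.proj K (φ y) = ψ (Alexiewicz.proj M y)) ∧
      MapsTo (Alexiewicz.gapAffineExt M φ) (Icc (sInf M) (sSup M)) (Icc (sInf K) (sSup K)) ∧
      (∀ᵐ y ∂(volume.restrict M), DifferentiableAt ℝ (Alexiewicz.gapAffineExt M φ) y) ∧
      -- the formula holds for every representative `g` of the class `f`
      ∀ (f : Alexiewicz.LInf K) (g : ℝ → ℝ), g =ᵐ[volume.restrict K] f →
        ∀ᵐ y ∂(volume.restrict M),
          T f y = ε * g (φ y) * deriv (Alexiewicz.gapAffineExt M φ) y := by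
  have hKne : K.Nonempty := nonempty_of_measure_ne_zero hK0.ne'
  have hMne : M.Nonempty := nonempty_of_measure_ne_zero hM0.ne'
  obtain ⟨ε, hε, hTε⟩ := hTψ
  obtain ⟨φ, hφ, hproj⟩ := hgap.exists_isIncreasingLipeo hK hM hKne hMne hψ
  have hmono : MonotoneOn φ M := hφ.strictMonoOn.monotoneOn
  have hdiff := Alexiewicz.ae_differentiableAt_gapAffineExt hM hmono
  refine ⟨ε, φ, hε, hφ, hproj, ?_, hdiff, fun f g hg => ?_⟩
  · exact (Alexiewicz.mapsTo_gapAffineExt hM hMne hmono).mono_right <| Icc_subset_Icc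
      (csInf_le hK.bddBelow (hφ.bijOn.mapsTo (hM.sInf_mem hMne)))
      (le_csSup hK.bddAbove (hφ.bijOn.mapsTo (hM.sSup_mem hMne)))
  · have hderiv : ∀ᵐ y ∂volume.restrict M,
        HasDerivWithinAt φ (deriv (Alexiewicz.gapAffineExt M φ) y) M y := by
      filter_upwards [hdiff, ae_restrict_mem hM.measurableSet] with y hy hyM
      exact hy.hasDerivAt.hasDerivWithinAt.congr_of_mem
        (Alexiewicz.gapAffineExt_eqOn M φ).symm hyM
    refine Alexiewicz.ae_eq_mul_comp_mul_of_primitive_eq hK hM hφ hderiv (fun y hy => ?_) hg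
    rw [hTε f y hy, ← hproj y hy, Alexiewicz.primitive_selector hK f (hφ.bijOn.mapsTo hy)]
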